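/- Let $G$ be a finite group and let $x, d \in G\setminus\{1\}$, where $x$ is not a central involution of $G$ (that is, not both $x\in \mathbf{Z}(G)$ and $x^2=1$). Let $K = x^G$ and $D = d^G$ be the conjugacy classes of $x$ and $d$ in $G$, let $K^2=\{ab : a,b\in K\}$, and let $\mathrm{Irr}(G)$ be the set of irreducible complex characters of $G$. Then the following are equivalent: a) $K^2 = \{1\} \cup D$; b) for every $\chi \in \mathrm{Irr}(G)$, $$|K|\,\chi(x)^2 = \chi(1)^2 + (|K|-1)\,\chi(1)\,\chi(d).$$ -/

import Mathlib

open scoped Pointwise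

/-- `Irr(G)`: the set of (ordinary) irreducible characters of `G`, as functions `G → ℂ`. These are
the trace functions of the irreducible representations of `G` on the spaces `ℂⁿ`; every
finite-dimensional complex representation of `G` is isomorphic to one on some `ℂⁿ`, so these are
all irreducible complex characters (see `character_mem_irr`). -/
def Irr (G : Type*) [Group G] : Set (G → ℂ) :=
  {χ | ∃ (n : ℕ) (ρ : Representation ℂ G (Fin n → ℂ)), ρ.IsIrreducible ∧ χ = ρ.character}

/-- The character of an irreducible representation on any finite-dimensional complex vector space,
in any universe, belongs to `Irr G`. -/
theorem character_mem_irr {G V : Type*} [Group G] [AddCommGroup V] [Module ℂ V]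
    [FiniteDimensional ℂ V] (ρ : Representation ℂ G V) (hρ : ρ.IsIrreducible) :
    ρ.character ∈ Irr G := by
  let e : V ≃ₗ[ℂ] (Fin (Module.finrank ℂ V) → ℂ) := (Module.finBasis ℂ V).equivFun
  let σ : Representation ℂ G (Fin (Module.finrank ℂ V) → ℂ) :=
    { toFun := fun g => e.conj (ρ g)
      map_one' := by ext; simp [LinearEquiv.conj_apply]
      map_mul' := fun g h => by ext; simp [LinearEquiv.conj_apply] }
  refine ⟨_, σ, ?_, funext fun g => (LinearMap.trace_conj' (ρ g) e).symm⟩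
  let F : Subrepresentation σ ≃o Subrepresentation ρ :=
    { toFun := fun S => ⟨S.toSubmodule.comap e.toLinearMap, fun g v hv => by
        have := S.apply_mem_toSubmodule g hv
        simpa [σ, LinearEquiv.conj_apply] using this⟩
      invFun := fun S => ⟨S.toSubmodule.comap e.symm.toLinearMap, fun g v hv => by
        have := S.apply_mem_toSubmodule g hv
        simpa [σ, LinearEquiv.conj_apply] using this⟩
      left_inv := fun S => by ext v; simp
      right_inv := fun S => by ext v; simp
      map_rel_iff' := fun {S T} =>
        ⟨fun h v hv => by
          have h1 := @h (e.symm v) (show e (e.symm v) ∈ S.toSubmodule by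
            rw [e.apply_symm_apply]; exact hv)
          have h2 : e (e.symm v) ∈ T.toSubmodule := h1
          rw [e.apply_symm_apply] at h2
          exact h2, fun h v hv => h hv⟩ }
  have : IsSimpleOrder (Subrepresentation ρ) := hρ
  exact F.isSimpleOrder

/-! Write `S` for the sum of χ(ab) over a, b in K. By Schur's lemma the class sum of K acts as a
scalar in an irreducible representation, so χ(1)S = (|K|χ(x))², and (b) says that S = |K|(χ(1) +
(|K|-1)χ(d)) for every χ. Given (a), K is closed under inverses, and counting products gives this
value. Conversely, irreducible characters separate class functions
(`eq_zero_of_forall_irr_sum_eq_zero`), so these sums determine how often each g is a product ab; the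
support of that count is {1} ∪ D. -/

namespace Representation

/-! ### Schur's lemma and central characters. -/

variable {G V : Type*} [Group G] [AddCommGroup V] [Module ℂ V]

theorem IsIrreducible.nontrivial {ρ : Representation ℂ G V} (hρ : ρ.IsIrreducible) :
    Nontrivial V := by
  by_contra h
  rw [not_nontrivial_iff_subsingleton] at h
  have : IsSimpleOrder (Subrepresentation ρ) := hρ
  refine (bot_ne_top : (⊥ : Subrepresentation ρ) ≠ ⊤) ?_
  exact Subrepresentation.toSubmodule_injective (Subsingleton.elim _ _)

theorem IsIrreducible.char_one_ne_zero [FiniteDimensional ℂ V] {ρ : Representation ℂ G V}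
    (hρ : ρ.IsIrreducible) : ρ.character 1 ≠ 0 := by
  have := hρ.nontrivial
  rw [char_one]
  exact_mod_cast Module.finrank_pos.ne'

variable [Fintype G]

/-- The operator `∑ g, f g • ρ g` attached to a class function `f`, as an endomorphism of `ρ`. -/
noncomputable def classFunctionMap (ρ : Representation ℂ G V) (f : G → ℂ)
    (hf : ∀ g h, f (h * g * h⁻¹) = f g) : IntertwiningMap ρ ρ where
  toLinearMap := ∑ g, f g • ρ g
  isIntertwining' h := by
    ext v
    simp only [LinearMap.comp_apply, LinearMap.sum_apply, LinearMap.smul_apply, map_sum, map_smul]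
    refine Fintype.sum_equiv (MulAut.conj h).toEquiv.symm _ _ fun g => ?_
    have h1 : (MulAut.conj h).toEquiv.symm g = h⁻¹ * g * h := rfl
    rw [h1, ← Module.End.mul_apply, ← Module.End.mul_apply, ← map_mul, ← map_mul]
    have := hf g h⁻¹
    rw [inv_inv] at this
    rw [this]
    congr 3
    group

theorem classFunctionMap_toLinearMap (ρ : Representation ℂ G V) (f : G → ℂ)
    (hf : ∀ g h, f (h * g * h⁻¹) = f g) :
    (classFunctionMap ρ f hf).toLinearMap = ∑ g, f g • ρ g := rfl

/-- Schur's lemma for the operator attached to a class function. -/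
theorem IsIrreducible.exists_sum_smul_eq [FiniteDimensional ℂ V] {ρ : Representation ℂ G V}
    (hρ : ρ.IsIrreducible) (f : G → ℂ) (hf : ∀ g h, f (h * g * h⁻¹) = f g) :
    ∃ c : ℂ, ∑ g, f g • ρ g = c • (1 : V →ₗ[ℂ] V) := by
  have := hρ
  obtain ⟨c, hc⟩ :=
    (IsIrreducible.algebraMap_intertwiningMap_bijective_of_isAlgClosed (k := ℂ) (ρ := ρ)).2
      (classFunctionMap ρ f hf)
  refine ⟨c, ?_⟩
  rw [← classFunctionMap_toLinearMap ρ f hf, ← hc]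
  rfl

theorem trace_sum_smul [FiniteDimensional ℂ V] (ρ : Representation ℂ G V) (f : G → ℂ) :
    LinearMap.trace ℂ V (∑ g, f g • ρ g) = ∑ g, f g * ρ.character g := by
  simp [character]

theorem IsIrreducible.sum_smul_eq_zero [FiniteDimensional ℂ V] {ρ : Representation ℂ G V}
    (hρ : ρ.IsIrreducible) (f : G → ℂ) (hf : ∀ g h, f (h * g * h⁻¹) = f g)
    (h0 : ∑ g, f g * ρ.character g = 0) : ∑ g, f g • ρ g = 0 := by
  obtain ⟨c, hc⟩ := hρ.exists_sum_smul_eq f hf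
  rw [← trace_sum_smul, hc, map_smul, LinearMap.trace_one, ← char_one ρ, smul_eq_mul] at h0
  rw [hc, (mul_eq_zero.1 h0).resolve_right hρ.char_one_ne_zero, zero_smul]

/-- The operator of `f` is a scalar c, so its square is c²; compare the traces cχ(1) and c²χ(1). -/
theorem IsIrreducible.char_one_mul_sum_sum [FiniteDimensional ℂ V] {ρ : Representation ℂ G V}
    (hρ : ρ.IsIrreducible) (f : G → ℂ) (hf : ∀ g h, f (h * g * h⁻¹) = f g) :
    ρ.character 1 * ∑ a, ∑ b, f a * f b * ρ.character (a * b) =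
      (∑ g, f g * ρ.character g) ^ 2 := by
  obtain ⟨c, hc⟩ := hρ.exists_sum_smul_eq f hf
  have h1 : ∑ g, f g * ρ.character g = c * ρ.character 1 := by
    rw [← trace_sum_smul, hc, map_smul, LinearMap.trace_one, ← char_one ρ, smul_eq_mul]
  have h2 : ∑ a, ∑ b, f a * f b * ρ.character (a * b) = c * (c * ρ.character 1) := by
    rw [char_one, ← LinearMap.trace_one, ← smul_eq_mul c, ← smul_eq_mul c, ← map_smul, ← map_smul,
      ← one_mul (1 : V →ₗ[ℂ] V), ← mul_smul_comm c, ← smul_mul_assoc, ← hc,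
      Finset.sum_mul_sum]
    simp [character, mul_assoc, mul_left_comm]
  rw [h1, h2]
  ring

end Representation

namespace Subrepresentation

variable {G V : Type*} [Group G] [AddCommGroup V] [Module ℂ V] {ρ : Representation ℂ G V}

/-- Subrepresentations of a subrepresentation `S` are the subrepresentations contained in `S`. -/
def orderIsoIic (S : Subrepresentation ρ) :
    Subrepresentation S.toRepresentation ≃o Set.Iic S where
  toFun T := ⟨⟨T.toSubmodule.map S.toSubmodule.subtype, by
      rintro g _ ⟨v, hv, rfl⟩
      exact ⟨_, T.apply_mem_toSubmodule g hv, rfl⟩⟩, by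
      rintro _ ⟨v, hv, rfl⟩
      exact v.2⟩
  invFun T := ⟨T.1.toSubmodule.comap S.toSubmodule.subtype, fun g _ hv =>
    T.1.apply_mem_toSubmodule g hv⟩
  left_inv T := toSubmodule_injective <|
    Submodule.comap_map_eq_of_injective S.toSubmodule.injective_subtype _
  right_inv T := Subtype.ext <| toSubmodule_injective <| by
    have : T.1.toSubmodule ≤ S.toSubmodule := T.2
    simpa using this
  map_rel_iff' {T U} :=
    Submodule.map_le_map_iff_of_injective S.toSubmodule.injective_subtype _ _

theorem isIrreducible_of_isAtom {S : Subrepresentation ρ} (hS : IsAtom S) :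
    S.toRepresentation.IsIrreducible := by
  have := Set.isSimpleOrder_Iic_iff_isAtom.2 hS
  exact S.orderIsoIic.isSimpleOrder

end Subrepresentation

/-! ### Separation of class functions by irreducible characters. -/

section Separation

variable {G : Type*} [Group G] [Fintype G]

theorem Representation.sum_smul_eq_zero_of_forall_irr {V : Type*} [AddCommGroup V] [Module ℂ V]
    [FiniteDimensional ℂ V] (ρ : Representation ℂ G V) (f : G → ℂ)
    (hf : ∀ g h, f (h * g * h⁻¹) = f g) (h0 : ∀ χ ∈ Irr G, ∑ g, f g * χ g = 0) :
    ∑ g, f g • ρ g = 0 := by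
  let e := Subrepresentation.subrepresentationSubmoduleOrderIso (ρ := ρ)
  have key : (⊤ : Subrepresentation ρ) ≤
      Representation.IntertwiningMap.ker _ _ (Representation.classFunctionMap ρ f hf) := by
    -- By Maschke's theorem the submodule lattice is atomistic, so it suffices that the kernel
    -- contains every irreducible subrepresentation.
    rw [← e.le_iff_le, le_iff_atom_le_imp]
    intro A hA _
    rw [← e.symm_apply_le]
    set S := e.symm A
    have hS : IsAtom S := (e.symm.isAtom_iff A).2 hA
    intro v hv
    have hirr := Subrepresentation.isIrreducible_of_isAtom hS
    have h := hirr.sum_smul_eq_zero f hf (h0 _ (character_mem_irr _ hirr))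
    have h' := congrArg (Subtype.val) (LinearMap.congr_fun h ⟨v, hv⟩)
    rw [Representation.IntertwiningMap.mem_ker, ← Representation.IntertwiningMap.toLinearMap_apply,
      Representation.classFunctionMap_toLinearMap]
    simpa [LinearMap.sum_apply, Subrepresentation.toRepresentation] using h'
  refine LinearMap.ext fun v => ?_
  exact (Representation.IntertwiningMap.mem_ker _ _ _ _).1 (key (Submodule.mem_top (x := v)))

/-- Irreducible characters separate class functions. -/
theorem eq_zero_of_forall_irr_sum_eq_zero (f : G → ℂ) (hf : ∀ g h, f (h * g * h⁻¹) = f g)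
    (h0 : ∀ χ ∈ Irr G, ∑ g, f g * χ g = 0) (g : G) : f g = 0 := by
  classical
  have h := Representation.sum_smul_eq_zero_of_forall_irr
    (Representation.leftRegular ℂ G) f hf h0
  -- Applied to the identity of the group algebra, the operator returns `f` itself, whose
  -- coefficient at `g` is `f g`.
  have h1 := LinearMap.congr_fun h (MonoidAlgebra.single 1 1)
  have h2 := congrArg (fun v : MonoidAlgebra ℂ G => v.coeff g) h1
  simpa [LinearMap.sum_apply, Finsupp.single_apply] using h2

end Separation

/-! ### Class sums and the products of two conjugates. -/

section ConjugacyClass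

variable {G : Type*} [Group G]

theorem apply_conj_of_mem_irr {χ : G → ℂ} (hχ : χ ∈ Irr G) (g h : G) :
    χ (h * g * h⁻¹) = χ g := by
  obtain ⟨n, ρ, -, rfl⟩ := hχ
  exact ρ.char_conj g h

theorem apply_eq_of_isConj_of_mem_irr {χ : G → ℂ} (hχ : χ ∈ Irr G) {g h : G} (hgh : IsConj g h) :
    χ h = χ g := by
  obtain ⟨c, rfl⟩ := isConj_iff.1 hgh
  exact apply_conj_of_mem_irr hχ g c

theorem apply_one_ne_zero_of_mem_irr {χ : G → ℂ} (hχ : χ ∈ Irr G) : χ 1 ≠ 0 := by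
  obtain ⟨n, ρ, hρ, rfl⟩ := hχ
  exact hρ.char_one_ne_zero

theorem isConj_conj_right_iff (x g h : G) : IsConj x (h * g * h⁻¹) ↔ IsConj x g :=
  have hc : IsConj g (h * g * h⁻¹) := isConj_iff.2 ⟨h, rfl⟩
  ⟨fun H => H.trans hc.symm, fun H => H.trans hc⟩

variable [Fintype G]

open Classical in
/-- The conjugacy class of `x`, as a finset. -/
noncomputable def conjFinset (x : G) : Finset G := {g | IsConj x g}

theorem mem_conjFinset {x g : G} : g ∈ conjFinset x ↔ IsConj x g := by
  simp [conjFinset]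

theorem coe_conjFinset (x : G) : (conjFinset x : Set G) = conjugatesOf x :=
  Set.ext fun _ => mem_conjFinset

theorem natCard_conjugatesOf (x : G) : Nat.card (conjugatesOf x) = (conjFinset x).card := by
  rw [← coe_conjFinset]
  simp

theorem card_conjFinset_ne_zero (x : G) : ((conjFinset x).card : ℂ) ≠ 0 := by
  exact_mod_cast (Finset.card_pos.2 ⟨x, mem_conjFinset.2 (IsConj.refl x)⟩).ne'

theorem sum_conjFinset_eq {χ : G → ℂ} (hχ : χ ∈ Irr G) (x : G) :
    ∑ g ∈ conjFinset x, χ g = (conjFinset x).card * χ x := by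
  rw [Finset.sum_congr rfl fun g hg =>
    apply_eq_of_isConj_of_mem_irr hχ (mem_conjFinset.1 hg)]
  simp

/-- The central character identity for the square of the class sum of `x`. -/
theorem apply_one_mul_sum_conjFinset {χ : G → ℂ} (hχ : χ ∈ Irr G) (x : G) :
    χ 1 * ∑ a ∈ conjFinset x, ∑ b ∈ conjFinset x, χ (a * b) =
      ((conjFinset x).card * χ x) ^ 2 := by
  classical
  rw [← sum_conjFinset_eq hχ]
  obtain ⟨n, ρ, hρ, rfl⟩ := hχ
  have h := hρ.char_one_mul_sum_sum (fun g => if g ∈ conjFinset x then 1 else 0)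
    (fun g h => by simp only [mem_conjFinset, isConj_conj_right_iff])
  simpa [ite_and, Finset.sum_ite_mem, ← Finset.sum_filter] using h

/-- By the central character identity, the two equations differ by the nonzero factor |K|/χ(1). -/
theorem irr_identity_iff {χ : G → ℂ} (hχ : χ ∈ Irr G) (x d : G) :
    ((conjFinset x).card : ℂ) * χ x ^ 2 =
        χ 1 ^ 2 + ((conjFinset x).card - 1 : ℂ) * χ 1 * χ d ↔
      ∑ a ∈ conjFinset x, ∑ b ∈ conjFinset x, χ (a * b) =
        (conjFinset x).card * (χ 1 + ((conjFinset x).card - 1) * χ d) := by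
  have h := apply_one_mul_sum_conjFinset hχ x
  have h1 := apply_one_ne_zero_of_mem_irr hχ
  have h2 := card_conjFinset_ne_zero x
  constructor
  · intro H
    refine mul_left_cancel₀ h1 ?_
    rw [h]
    linear_combination ((conjFinset x).card : ℂ) * H
  · intro H
    refine mul_left_cancel₀ h2 ?_
    rw [H] at h
    linear_combination -h

theorem sum_sum_conjFinset_of_mul_eq {χ : G → ℂ} (hχ : χ ∈ Irr G) {x d : G}
    (h : conjugatesOf x * conjugatesOf x = {1} ∪ conjugatesOf d) :
    ∑ a ∈ conjFinset x, ∑ b ∈ conjFinset x, χ (a * b) =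
      (conjFinset x).card * (χ 1 + ((conjFinset x).card - 1) * χ d) := by
  classical
  -- Since 1 is in K², K contains some u together with u⁻¹.
  have hinv : IsConj x x⁻¹ := by
    have h1 : (1 : G) ∈ conjugatesOf x * conjugatesOf x := h ▸ Or.inl rfl
    obtain ⟨u, hu, v, hv, huv⟩ := h1
    have hv' : v = u⁻¹ := (inv_eq_of_mul_eq_one_right huv).symm
    subst hv'
    obtain ⟨c, hc⟩ := isConj_iff.1 (show IsConj x u from hu)
    refine IsConj.trans (show IsConj x u⁻¹ from hv) (IsConj.symm (isConj_iff.2 ⟨c, ?_⟩))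
    rw [← hc]
    group
  rw [← nsmul_eq_mul]
  refine Finset.sum_eq_card_nsmul fun a ha => ?_
  rw [mem_conjFinset] at ha
  have ha' : a⁻¹ ∈ conjFinset x := by
    obtain ⟨c, rfl⟩ := isConj_iff.1 ha
    rw [mem_conjFinset]
    exact hinv.trans (isConj_iff.2 ⟨c, by group⟩)
  -- For fixed a, only b = a⁻¹ gives 1; the other |K|-1 products lie in D.
  rw [← Finset.add_sum_erase _ _ ha', mul_inv_cancel,
    Finset.sum_congr rfl (g := fun _ => χ d) fun b hb => ?_, Finset.sum_const,
    Finset.card_erase_of_mem ha', nsmul_eq_mul, Nat.cast_sub (Finset.card_pos.2 ⟨_, ha'⟩),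
    Nat.cast_one]
  rw [Finset.mem_erase, mem_conjFinset] at hb
  have hab : a * b ∈ ({1} ∪ conjugatesOf d : Set G) := h ▸ Set.mul_mem_mul ha hb.2
  rcases hab with hab | hab
  · exact absurd (inv_eq_of_mul_eq_one_right hab).symm hb.1
  · exact apply_eq_of_isConj_of_mem_irr hχ hab

open Classical in
/-- The structure constants of `K * K` are determined by the values of the irreducible
characters on the products. -/
theorem sum_sum_ite_mul_eq {x d : G}
    (h : ∀ χ ∈ Irr G, ∑ a ∈ conjFinset x, ∑ b ∈ conjFinset x, χ (a * b) =
      (conjFinset x).card * (χ 1 + ((conjFinset x).card - 1) * χ d)) (g : G) :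
    ∑ a ∈ conjFinset x, ∑ b ∈ conjFinset x, (if a * b = g then 1 else 0 : ℂ) =
      (if g = 1 then ((conjFinset x).card : ℂ) else 0) +
        if g ∈ conjFinset d then
          ((conjFinset x).card * ((conjFinset x).card - 1) / (conjFinset d).card : ℂ) else 0 := by
  -- |K| of the |K|² pairs are accounted for at 1, and the remaining |K|(|K|-1) are spread evenly
  -- over D.
  refine sub_eq_zero.1 (eq_zero_of_forall_irr_sum_eq_zero (fun g =>
    (∑ a ∈ conjFinset x, ∑ b ∈ conjFinset x, (if a * b = g then 1 else 0 : ℂ)) -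
      ((if g = 1 then ((conjFinset x).card : ℂ) else 0) + if g ∈ conjFinset d then
        ((conjFinset x).card * ((conjFinset x).card - 1) / (conjFinset d).card : ℂ) else 0))
    ?_ ?_ g)
  · intro g c
    have hone : c * g * c⁻¹ = 1 ↔ g = 1 := by simp [mul_inv_eq_one]
    simp only [mem_conjFinset, isConj_conj_right_iff, hone]
    congr 1
    have hbij : ∀ F : G → ℂ, ∑ a ∈ conjFinset x, F a = ∑ a ∈ conjFinset x, F (c * a * c⁻¹) := by
      intro F
      symm
      refine Finset.sum_equiv (MulAut.conj c).toEquiv (fun a => ?_) fun a _ => rfl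
      rw [mem_conjFinset, mem_conjFinset]
      exact (isConj_conj_right_iff x a c).symm
    rw [hbij]
    refine Finset.sum_congr rfl fun a _ => ?_
    rw [hbij]
    refine Finset.sum_congr rfl fun b _ => ?_
    have : c * a * c⁻¹ * (c * b * c⁻¹) = c * (a * b) * c⁻¹ := by group
    rw [this]
    simp
  · intro χ hχ
    have h1 : ∑ g, (∑ a ∈ conjFinset x, ∑ b ∈ conjFinset x, (if a * b = g then 1 else 0 : ℂ)) * χ g
        = ∑ a ∈ conjFinset x, ∑ b ∈ conjFinset x, χ (a * b) := by
      simp_rw [Finset.sum_mul]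
      rw [Finset.sum_comm]
      refine Finset.sum_congr rfl fun a _ => ?_
      rw [Finset.sum_comm]
      simp
    simp only [sub_mul, add_mul, Finset.sum_sub_distrib, Finset.sum_add_distrib, h1, ite_mul,
      zero_mul, Finset.sum_ite_mem, Finset.univ_inter, Finset.sum_ite_eq', Finset.mem_univ, if_true,
      ← Finset.mul_sum, sum_conjFinset_eq hχ, h χ hχ]
    have := card_conjFinset_ne_zero d
    field_simp
    ring

theorem mem_conjugatesOf_mul_iff (x g : G) [DecidableEq G] :
    g ∈ conjugatesOf x * conjugatesOf x ↔
      ∑ a ∈ conjFinset x, ∑ b ∈ conjFinset x, (if a * b = g then 1 else 0 : ℂ) ≠ 0 := by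
  rw [← Finset.sum_product', ← Finset.sum_filter, Finset.sum_const, nsmul_one, Nat.cast_ne_zero,
    Finset.card_ne_zero, Set.mem_mul]
  constructor
  · rintro ⟨a, ha, b, hb, rfl⟩
    exact ⟨(a, b), by
      rw [Finset.mem_filter, Finset.mem_product, mem_conjFinset, mem_conjFinset]
      exact ⟨⟨ha, hb⟩, rfl⟩⟩
  · rintro ⟨⟨a, b⟩, hab⟩
    simp only [Finset.mem_filter, Finset.mem_product, mem_conjFinset] at hab
    exact ⟨a, hab.1.1, b, hab.1.2, hab.2⟩

theorem mem_center_of_card_conjFinset_eq_one {x : G} (h : (conjFinset x).card = 1) :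
    x ∈ Subgroup.center G := by
  obtain ⟨y, hy⟩ := Finset.card_eq_one.1 h
  have hmem : ∀ z, IsConj x z → z = y := fun z hz => by
    simpa [hy] using mem_conjFinset.2 hz
  rw [Subgroup.mem_center_iff]
  intro g
  have h1 := (hmem _ (isConj_iff.2 ⟨g, rfl⟩)).trans (hmem x (IsConj.refl x)).symm
  exact mul_inv_eq_iff_eq_mul.1 h1

theorem conjugatesOf_mul_eq {x d : G} (hd : d ≠ 1)
    (hcentral : ¬ (x ∈ Subgroup.center G ∧ x ^ 2 = 1))
    (h : ∀ χ ∈ Irr G, ∑ a ∈ conjFinset x, ∑ b ∈ conjFinset x, χ (a * b) =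
      (conjFinset x).card * (χ 1 + ((conjFinset x).card - 1) * χ d)) :
    conjugatesOf x * conjugatesOf x = {1} ∪ conjugatesOf d := by
  classical
  have hmem : ∀ g, g ∈ conjugatesOf x * conjugatesOf x ↔ _ := fun g => by
    rw [mem_conjugatesOf_mul_iff, sum_sum_ite_mul_eq h]
  have hK := card_conjFinset_ne_zero x
  have hD := card_conjFinset_ne_zero d
  have h1d : (1 : G) ∉ conjFinset d := fun H => hd (isConj_one_left.1 (mem_conjFinset.1 H))
  have hone : (1 : G) ∈ conjugatesOf x * conjugatesOf x := by
    simp [hmem, h1d, hK]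
  -- If |K| = 1, then x is central and K² = {x²}; as 1 is in K², x² = 1, which is excluded. So the
  -- coefficient on D does not vanish.
  have hcard : ((conjFinset x).card : ℂ) - 1 ≠ 0 := by
    intro H
    have hx := mem_center_of_card_conjFinset_eq_one (by exact_mod_cast sub_eq_zero.1 H)
    refine hcentral ⟨hx, ?_⟩
    have hconj : ∀ z, IsConj x z → z = x := by
      intro z hz
      obtain ⟨c, rfl⟩ := isConj_iff.1 hz
      rw [Subgroup.mem_center_iff.1 hx c, mul_inv_cancel_right]
    obtain ⟨u, hu, v, hv, huv⟩ := hone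
    rw [← hconj u hu, sq]
    nth_rewrite 2 [hconj u hu]
    rw [← hconj v hv]
    exact huv
  ext g
  rw [hmem]
  change _ ↔ g = 1 ∨ IsConj d g
  rw [← mem_conjFinset]
  by_cases hg : g = 1
  · subst hg
    simp [h1d, hK]
  · by_cases hgd : g ∈ conjFinset d
    · simpa only [hg, hgd, if_true, if_false, zero_add, true_iff, false_or, iff_true] using
        div_ne_zero (mul_ne_zero hK hcard) hD
    · simp [hg, hgd]

end ConjugacyClass

theorem theoremB {G : Type*} [Group G] [Finite G] (x d : G) (hx : x ≠ 1) (hd : d ≠ 1)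
    (hcentral : ¬ (x ∈ Subgroup.center G ∧ x ^ 2 = 1)) :
    conjugatesOf x * conjugatesOf x = {1} ∪ conjugatesOf d ↔
      ∀ χ ∈ Irr G,
        (Nat.card (conjugatesOf x) : ℂ) * χ x ^ 2 =
          χ 1 ^ 2 + ((Nat.card (conjugatesOf x) : ℂ) - 1) * χ 1 * χ d := by
  have := Fintype.ofFinite G
  rw [natCard_conjugatesOf]
  exact ⟨fun h χ hχ => (irr_identity_iff hχ x d).2 (sum_sum_conjFinset_of_mul_eq hχ h),
    fun h => conjugatesOf_mul_eq hd hcentral fun χ hχ => (irr_identity_iff hχ x d).1 (h χ hχ)⟩
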